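/- **Theorem.** Let $\lambda$ be Lebesgue measure on $\mathbb{R}$. For Borel probability measures $\mu,\nu$ on $\mathbb{R}$ with distribution functions $F_\mu,F_\nu$ (and $F_{\mu-}$ the left limit of $F_\mu$) and $\varepsilon>0$, let $$d_\varepsilon(\mu,\nu)=\inf\bigl\{y>0:\ F_{\mu-}(t-y/\varepsilon)-y\le F_\nu(t)\le F_\mu(t+y/\varepsilon)+y\ \text{ for all } t\in\mathbb{R}\bigr\}.$$ For $n\ge 1$ let $\Xi_n=\{x\in\mathbb{R}^n: x_1\le\dots\le x_n\}$, $\Pi_n=\{p\in\mathbb{R}^n:p_j\ge 0,\ \sum_{j}p_j=1\}$, and for $x\in\Xi_n$, $p\in\Pi_n$ let $\delta_x^p=\sum_{j=1}^n p_j\delta_{x_j}$. A sequence $(x_n)$ with $x_n=(x_{n,1},\dots,x_{n,n})\in\Xi_n$ for every $n$ is called *asymptotically $d_\varepsilon$-minimal* for $\mu$ if $$\lim_{n\to\infty}\frac{\inf_{p\in\Pi_n}d_\varepsilon(\mu,\delta_{x_n}^{p})}{\inf_{y\in\Xi_n,\,q\in\Pi_n}d_\varepsilon(\mu,\delta_y^q)}=1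 .$$ Let $\mu$ be a Borel probability measure on $\mathbb{R}$ whose absolutely continuous part $\mu_{\mathsf A}$ (in the Lebesgue decomposition of $\mu$ with respect to $\lambda$) is not zero, let $\varepsilon>0$, and let $(x_n)$ be asymptotically $d_\varepsilon$-minimal for $\mu$. Then for every interval $I\subset\mathbb{R}$ (bounded or not, open, closed or half-open, possibly degenerate), $$\lim_{n\to\infty}\frac{\#\{1\le j\le n: x_{n,j}\in I\}}{n}=\mu_\varepsilon^{*}(I),$$ where, with $\Omega(t)=\dfrac{t}{2+2|t|}$, $\mu_\varepsilon^{*}$ is the probability measure with density $$\frac{d\mu_\varepsilon^{*}}{d\lambda}=\frac{\Omega\!\left(\frac1\varepsilon\,\frac{d\mu_{\mathsf A}}{d\lambda}\right)}{\int_{\mathbb{R}}\Omega\!\left(\frac1\varepsilon\,\frac{d\mu_{\mathsf A}}{d\lambda}\right)d\lambda}.$$ -/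

import Mathlib

open MeasureTheory Set Filter Topology

noncomputable section

/-- The Lévy distance of two real functions: the infimum of all `y > 0` with
`f₋(x - y/ε) - y ≤ g x ≤ f (x + y/ε) + y` for every `x`, where `f₋` is the left limit. -/
def levyDistFun (ε : ℝ) (f g : ℝ → ℝ) : ℝ :=
  sInf {y : ℝ | 0 < y ∧
    ∀ x : ℝ, Function.leftLim f (x - y / ε) - y ≤ g x ∧ g x ≤ f (x + y / ε) + y}

/-- The `ε`-Lévy metric: the Lévy distance of the distribution functions. -/
def levyDist (ε : ℝ) (μ ν : Measure ℝ) : ℝ :=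
  levyDistFun ε (ProbabilityTheory.cdf μ) (ProbabilityTheory.cdf ν)

/-- `Ξ_n`: the non-decreasing vectors of `n` locations. -/
def locations (n : ℕ) : Set (Fin n → ℝ) := {x | Monotone x}

/-- `Π_n`: the probability vectors of length `n`. -/
def weights (n : ℕ) : Set (Fin n → ℝ) := {p | (∀ j, 0 ≤ p j) ∧ ∑ j, p j = 1}

/-- The atomic measure `∑ j, p_j δ_{x_j}`. -/
def atomicMeasure {n : ℕ} (x p : Fin n → ℝ) : Measure ℝ :=
  ∑ j, ENNReal.ofReal (p j) • Measure.dirac (x j)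

/-- `∑ j, p_j δ_{x_j}` is a best approximation of `μ` among all weights, for the given `x`. -/
def IsBestGivenLocations (ε : ℝ) (μ : Measure ℝ) {n : ℕ} (x p : Fin n → ℝ) : Prop :=
  p ∈ weights n ∧ ∀ q ∈ weights n,
    levyDist ε μ (atomicMeasure x p) ≤ levyDist ε μ (atomicMeasure x q)

/-- `∑ j, p_j δ_{x_j}` is a best approximation of `μ` among all locations and weights. -/
def IsBest (ε : ℝ) (μ : Measure ℝ) {n : ℕ} (x p : Fin n → ℝ) : Prop :=
  x ∈ locations n ∧ p ∈ weights n ∧ ∀ y ∈ locations n, ∀ q ∈ weights n,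
    levyDist ε μ (atomicMeasure x p) ≤ levyDist ε μ (atomicMeasure y q)

/-- The optimal error for the given locations `x`, minimised over the weights. -/
def bestErrorGiven (ε : ℝ) (μ : Measure ℝ) {n : ℕ} (x : Fin n → ℝ) : ℝ :=
  sInf {d : ℝ | ∃ p ∈ weights n, d = levyDist ε μ (atomicMeasure x p)}

/-- The optimal error with `n` atoms, minimised over the locations and the weights. -/
def bestError (ε : ℝ) (μ : Measure ℝ) (n : ℕ) : ℝ :=
  sInf {d : ℝ | ∃ x ∈ locations n, ∃ p ∈ weights n, d = levyDist ε μ (atomicMeasure x p)}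

theorem IsBestGivenLocations.levyDist_eq {ε : ℝ} {μ : Measure ℝ} {n : ℕ} {x p : Fin n → ℝ}
    (h : IsBestGivenLocations ε μ x p) :
    levyDist ε μ (atomicMeasure x p) = bestErrorGiven ε μ x := by
  refine Eq.symm (IsLeast.csInf_eq ?_)
  refine ⟨⟨p, h.1, rfl⟩, ?_⟩
  rintro d ⟨q, hq, rfl⟩
  exact h.2 q hq

theorem IsBest.levyDist_eq {ε : ℝ} {μ : Measure ℝ} {n : ℕ} {x p : Fin n → ℝ}
    (h : IsBest ε μ x p) :
    levyDist ε μ (atomicMeasure x p) = bestError ε μ n := by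
  refine Eq.symm (IsLeast.csInf_eq ?_)
  refine ⟨⟨x, h.1, p, h.2.1, rfl⟩, ?_⟩
  rintro d ⟨y, hy, q, hq, rfl⟩
  exact h.2.2 y hy q hq

/-- `(x_n)` is asymptotically minimal for `μ`: each `x_n` lies in `Ξ_n`, and the ratio of the
optimal error given `x_n` and the optimal error with `n` atoms tends to `1`.  (If `μ` has finite
support, the denominator is eventually `0` and the quotient does not tend to `1`.) -/
def IsAsymptoticallyMinimal (ε : ℝ) (μ : Measure ℝ) (x : (n : ℕ) → Fin n → ℝ) : Prop :=
  (∀ n, x n ∈ locations n) ∧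
    Tendsto (fun n : ℕ => bestErrorGiven ε μ (x n) / bestError ε μ n) atTop (𝓝 1)

/-- The function `Ω`. -/
def Omega (t : ℝ) : ℝ := t / (2 + 2 * |t|)

/-- The absolutely continuous part of `μ` in its Lebesgue decomposition with respect to
Lebesgue measure. -/
def acPart (μ : Measure ℝ) : Measure ℝ := volume.withDensity (μ.rnDeriv volume)

/-- The real-valued density of the absolutely continuous part of `μ`. -/
def acDensity (μ : Measure ℝ) (t : ℝ) : ℝ := ((acPart μ).rnDeriv volume t).toReal

/-- The measure `μ*_ε`, whose density is `Ω((1/ε) dμ_A/dλ)`, normalised. -/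
def pointDistribution (ε : ℝ) (μ : Measure ℝ) : Measure ℝ :=
  volume.withDensity fun t =>
    ENNReal.ofReal (Omega (1 / ε * acDensity μ t) / ∫ s, Omega (1 / ε * acDensity μ s))

end

/-!
Write `f` for the density of the absolutely continuous part of `μ` and `φ(u) = ε Ω(u/ε) =
ε u / (2 (ε + u))` (`pointRate`), so that `μ*_ε` has density `φ(f) / C` with `C = ∫ φ(f)`.

Locations `x` admit weights with error at most `y` precisely when every gap `(a, b)` between
consecutive locations satisfies `μ (a + y/ε, b - y/ε) ≤ 2 y`, and the two tails carry mass at most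
`y` (`gapBound_of_levyDist_lt`, `bestError_le_of_gapBound`). Where `μ` has constant density `c > 0`, a gap
can therefore have length at most `2 y (1/c + 1/ε) = y / φ(c)`: about `φ(c) / y` atoms are needed
per unit length.

*At least this many atoms are needed in each interval.* Let `g` be a continuous approximation of `f`
in `L¹`, and cut the interval into finitely many pieces on which `g` is nearly constant. On such a
piece each admissible gap accounts for at most `y` of the integral of `φ(f) - |f - g| - ρ`, where
`ρ` bounds the oscillation of `g`. Counting gaps gives that the number of atoms in `(a, b)` is at
least `(∫ φ(f) - η) / y - M`, with `M` independent of `y` (`setIntegral_pointRate_le_countIoo`).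

*Globally, no more are needed.* Choose the atoms greedily; then every gap, with its right end
included, has mass at least `2 y` (`exists_critical_gap`). On pieces where `g` is nearly constant
and the singular part is small, such a gap accounts for at least `y` of a slight enlargement of
`∫ φ(f)`. The singular part is, up to a small mass, carried by a compact null set; on a
neighbourhood of it of small length one uses only that a critical gap has length at least
`2 y / ε`. Hence
`(C + η) / y + M` atoms reach error `y` (`exists_gapChain_le_integral`), so that the minimal error
with `n` atoms is at most `D / n` eventually, for every `D > C`.

For asymptotically minimal locations the error is then also eventually below `D / n`, and the local
bound with `y = D / n` shows that the proportion of locations in an interval `I` is asymptotically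
at least `μ*_ε(I)`. The same holds for the two intervals that make up the complement of `I`, and all
three proportions add up to `1`, so each of these bounds is sharp.
-/

/-! ### The rate function -/

/-- The number of atoms per unit length, multiplied by the error `y`, that is needed where the
density is `u`: `ε Ω(u/ε) = ε u / (2 (ε + u))`. -/
noncomputable def pointRate (ε u : ℝ) : ℝ := ε * Omega (1 / ε * u)

theorem pointRate_eq {ε u : ℝ} (hε : 0 < ε) (hu : 0 ≤ u) :
    pointRate ε u = ε * u / (2 * (ε + u)) := by
  have h : 0 ≤ 1 / ε * u := by positivity
  rw [pointRate, Omega, abs_of_nonneg h]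
  have : 0 < ε + u := by positivity
  field_simp

theorem pointRate_nonneg {ε u : ℝ} (hε : 0 < ε) (hu : 0 ≤ u) : 0 ≤ pointRate ε u := by
  rw [pointRate_eq hε hu]; positivity

theorem pointRate_le_half {ε u : ℝ} (hε : 0 < ε) (hu : 0 ≤ u) : pointRate ε u ≤ u / 2 := by
  rw [pointRate_eq hε hu, div_le_div_iff₀ (by positivity) (by positivity)]
  nlinarith [mul_nonneg hu hu]

theorem pointRate_le_add {ε u v : ℝ} (hε : 0 < ε) (hu : 0 ≤ u) (hv : 0 ≤ v) :
    pointRate ε u ≤ pointRate ε v + |u - v| / 2 := by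
  rcases le_total u v with h | h
  · have : pointRate ε u ≤ pointRate ε v := by
      rw [pointRate_eq hε hu, pointRate_eq hε hv, div_le_div_iff₀ (by positivity) (by positivity)]
      nlinarith [mul_le_mul_of_nonneg_left h (mul_pos hε hε).le]
    linarith [abs_nonneg (u - v)]
  · rw [abs_of_nonneg (sub_nonneg.2 h)]
    have h1 : 0 < ε + u := by positivity
    have h2 : 0 < ε + v := by positivity
    have key : pointRate ε u - pointRate ε v = (u - v) / 2 * (ε ^ 2 / ((ε + u) * (ε + v))) := by
      rw [pointRate_eq hε hu, pointRate_eq hε hv]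
      field_simp
      ring
    have h3 : ε ^ 2 / ((ε + u) * (ε + v)) ≤ 1 := by
      rw [div_le_one (by positivity)]
      nlinarith [mul_nonneg hε.le hu, mul_nonneg hε.le hv, mul_nonneg hu hv]
    nlinarith [mul_le_mul_of_nonneg_left h3 (sub_nonneg.2 h)]

/-- A gap of length `L` whose interior, shortened by `y / ε` at either end, carries mass at most
`2 y`, when the measure is at least `c` times Lebesgue measure up to an error `τ`. -/
theorem pointRate_mul_le {ε c y L τ : ℝ} (hε : 0 < ε) (hc : 0 ≤ c) (hτ : 0 ≤ τ)
    (h : c * (L - 2 * (y / ε)) ≤ 2 * y + τ) : pointRate ε c * L ≤ y + τ / 2 := by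
  have h2 : 0 < ε + c := by positivity
  rw [pointRate_eq hε hc, div_mul_eq_mul_div, div_le_iff₀ (by positivity)]
  have h3 : ε * (c * (L - 2 * (y / ε))) ≤ ε * (2 * y + τ) := mul_le_mul_of_nonneg_left h hε.le
  have h4 : ε * (c * (L - 2 * (y / ε))) = ε * c * L - 2 * c * y := by field_simp
  nlinarith [mul_nonneg hc hτ]

/-- The converse of `pointRate_mul_le`, when the measure is at most `c` times Lebesgue measure up
to an error `τ`. -/
theorem le_pointRate_mul {ε c y L τ : ℝ} (hε : 0 < ε) (hc : 0 ≤ c) (hτ : 0 ≤ τ)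
    (h : 2 * y ≤ c * (L - 2 * (y / ε)) + τ) : y ≤ pointRate ε c * L + τ / 2 := by
  have h2 : 0 < ε + c := by positivity
  rw [pointRate_eq hε hc, div_mul_eq_mul_div, ← sub_le_iff_le_add, le_div_iff₀ (by positivity)]
  have h3 : ε * (2 * y) ≤ ε * (c * (L - 2 * (y / ε)) + τ) := mul_le_mul_of_nonneg_left h hε.le
  have h4 : ε * (c * (L - 2 * (y / ε)) + τ) = ε * c * L - 2 * c * y + ε * τ := by field_simp
  nlinarith [mul_nonneg hc hτ]

/-! ### The Lévy distance to atomic measures -/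

/-- The mass condition on a gap `(a, b)` between consecutive atoms that is equivalent to error at
most `y`: `μ` gives mass at most `2 y` to `(a + y/ε, b - y/ε)`, in terms of the distribution
function. -/
def GapBound (ε : ℝ) (μ : Measure ℝ) (y a b : ℝ) : Prop :=
  Function.leftLim (ProbabilityTheory.cdf μ) (b - y / ε)
    ≤ ProbabilityTheory.cdf μ (a + y / ε) + 2 * y

theorem gapBound_self {ε : ℝ} (hε : 0 < ε) (μ : Measure ℝ) {y : ℝ} (hy : 0 ≤ y) (a : ℝ) :
    GapBound ε μ y a a := by
  have h1 : Function.leftLim (ProbabilityTheory.cdf μ) (a - y / ε)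
      ≤ ProbabilityTheory.cdf μ (a + y / ε) :=
    (ProbabilityTheory.monotone_cdf μ).leftLim_le (by have := div_nonneg hy hε.le; linarith)
  unfold GapBound
  linarith

theorem leftLim_cdf_le_one (μ : Measure ℝ) (t : ℝ) :
    Function.leftLim (ProbabilityTheory.cdf μ) t ≤ 1 :=
  ((ProbabilityTheory.monotone_cdf μ).leftLim_le le_rfl).trans (ProbabilityTheory.cdf_le_one μ t)

theorem atomicMeasure_real {n : ℕ} {x p : Fin n → ℝ} (hp : ∀ j, 0 ≤ p j) {A : Set ℝ}
    [DecidablePred (· ∈ A)] (hA : MeasurableSet A) :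
    (atomicMeasure x p).real A = ∑ j, if x j ∈ A then p j else 0 := by
  rw [atomicMeasure, measureReal_def, Measure.finsetSum_apply, ENNReal.toReal_sum]
  · refine Finset.sum_congr rfl fun j _ => ?_
    rw [Measure.smul_apply, Measure.dirac_apply' _ hA]
    by_cases h : x j ∈ A
    · simp [h, hp j]
    · simp [h]
  · intro j _
    rw [Measure.smul_apply, Measure.dirac_apply' _ hA]
    by_cases h : x j ∈ A <;> simp [h]

theorem isProbabilityMeasure_atomicMeasure {n : ℕ} {x p : Fin n → ℝ} (hp : p ∈ weights n) :
    IsProbabilityMeasure (atomicMeasure x p) := by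
  constructor
  rw [atomicMeasure, Measure.finsetSum_apply]
  simp only [Measure.smul_apply, measure_univ, smul_eq_mul, mul_one]
  rw [← ENNReal.ofReal_sum_of_nonneg fun j _ => hp.1 j, hp.2, ENNReal.ofReal_one]

theorem cdf_atomicMeasure {n : ℕ} {x p : Fin n → ℝ} (hp : p ∈ weights n) (t : ℝ) :
    ProbabilityTheory.cdf (atomicMeasure x p) t = ∑ j, if x j ≤ t then p j else 0 := by
  have := isProbabilityMeasure_atomicMeasure (x := x) hp
  classical
  rw [ProbabilityTheory.cdf_eq_real, atomicMeasure_real hp.1 measurableSet_Iic]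
  simp only [mem_Iic]

theorem levyDist_nonneg (ε : ℝ) (μ ν : Measure ℝ) : 0 ≤ levyDist ε μ ν :=
  Real.sInf_nonneg fun _ hy => hy.1.le

theorem levyDist_le {ε : ℝ} {μ ν : Measure ℝ} {y : ℝ} (hy : 0 < y)
    (h : ∀ t, Function.leftLim (ProbabilityTheory.cdf μ) (t - y / ε) - y
        ≤ ProbabilityTheory.cdf ν t ∧
      ProbabilityTheory.cdf ν t ≤ ProbabilityTheory.cdf μ (t + y / ε) + y) :
    levyDist ε μ ν ≤ y :=
  csInf_le ⟨0, fun _ hz => hz.1.le⟩ ⟨hy, h⟩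

theorem of_levyDist_lt {ε : ℝ} (hε : 0 < ε) {μ ν : Measure ℝ} {y : ℝ} (h : levyDist ε μ ν < y)
    (t : ℝ) : Function.leftLim (ProbabilityTheory.cdf μ) (t - y / ε) - y
        ≤ ProbabilityTheory.cdf ν t ∧
      ProbabilityTheory.cdf ν t ≤ ProbabilityTheory.cdf μ (t + y / ε) + y := by
  -- The infimum is over a nonempty set, since every `y ≥ 1` is admissible.
  have hne : {y : ℝ | 0 < y ∧ ∀ x : ℝ,
      Function.leftLim (ProbabilityTheory.cdf μ) (x - y / ε) - y ≤ ProbabilityTheory.cdf ν x ∧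
      ProbabilityTheory.cdf ν x ≤ ProbabilityTheory.cdf μ (x + y / ε) + y}.Nonempty := by
    refine ⟨1, one_pos, fun x => ⟨?_, ?_⟩⟩
    · linarith [leftLim_cdf_le_one μ (x - 1 / ε), ProbabilityTheory.cdf_nonneg ν x]
    · linarith [ProbabilityTheory.cdf_le_one ν x, ProbabilityTheory.cdf_nonneg μ (x + 1 / ε)]
  obtain ⟨z, ⟨hz, hz'⟩, hzy⟩ := exists_lt_of_csInf_lt hne h
  have hd : z / ε ≤ y / ε := by gcongr
  obtain ⟨h1, h2⟩ := hz' t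
  have h3 := (ProbabilityTheory.monotone_cdf μ).leftLim (show t - y / ε ≤ t - z / ε by linarith)
  have h4 := (ProbabilityTheory.monotone_cdf μ) (show t + z / ε ≤ t + y / ε by linarith)
  exact ⟨by linarith, by linarith⟩

theorem gapBound_of_levyDist_lt {ε : ℝ} (hε : 0 < ε) {μ : Measure ℝ} {n : ℕ} {x p : Fin n → ℝ}
    (hp : p ∈ weights n) {y : ℝ} (h : levyDist ε μ (atomicMeasure x p) < y) {a b : ℝ}
    (hab : a < b) (hx : ∀ j, x j ∉ Ioo a b) : GapBound ε μ y a b := by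
  -- The distribution function of the atomic measure is constant on `[a, b)`.
  have hG : ∀ t ∈ Ioo a b, ProbabilityTheory.cdf (atomicMeasure x p) t
      = ProbabilityTheory.cdf (atomicMeasure x p) a := by
    intro t ht
    rw [cdf_atomicMeasure hp, cdf_atomicMeasure hp]
    refine Finset.sum_congr rfl fun j _ => ?_
    have : x j ≤ t ↔ x j ≤ a :=
      ⟨fun h => not_lt.1 fun h' => hx j ⟨h', h.trans_lt ht.2⟩, fun h => h.trans ht.1.le⟩
    simp only [this]
  have ha := (of_levyDist_lt hε h a).2
  refine le_of_tendsto ((ProbabilityTheory.monotone_cdf μ).tendsto_leftLim (b - y / ε)) ?_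
  filter_upwards [Ioo_mem_nhdsLT (show a - y / ε < b - y / ε by linarith)] with s hs
  obtain ⟨t, hst, htb⟩ := exists_between hs.2
  have h1 := (of_levyDist_lt hε h (t + y / ε)).1
  rw [hG _ ⟨by linarith [hs.1], by linarith⟩, add_sub_cancel_right] at h1
  have h2 := (ProbabilityTheory.monotone_cdf μ).le_leftLim hst
  linarith

theorem exists_forall_le_iff_lt {x : ℕ → ℝ} (hx : Monotone x) (t : ℝ) (N : ℕ) :
    ∃ k ≤ N, ∀ j < N, x j ≤ t ↔ j < k := by
  induction N with
  | zero => exact ⟨0, le_rfl, by simp⟩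
  | succ N ih =>
    by_cases h : x N ≤ t
    · exact ⟨N + 1, le_rfl, fun j hj =>
        ⟨fun _ => hj, fun _ => (hx (Nat.lt_succ_iff.1 hj)).trans h⟩⟩
    · obtain ⟨k, hk, hk'⟩ := ih
      refine ⟨k, by omega, fun j hj => ?_⟩
      rcases Nat.lt_succ_iff_lt_or_eq.1 hj with h' | rfl
      · exact hk' j h'
      · simp [h, hk]

/-- Locations with small enough gaps and tails admit weights with error at most `y`: the
distribution function is given the largest admissible values. -/
theorem bestError_le_of_gapBound {ε : ℝ} (μ : Measure ℝ) {y : ℝ} (hy : 0 < y)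
    {x : ℕ → ℝ} (hx : Monotone x) (m : ℕ) (hgap : ∀ i, GapBound ε μ y (x i) (x (i + 1)))
    (hleft : Function.leftLim (ProbabilityTheory.cdf μ) (x 0 - y / ε) ≤ y)
    (hright : 1 ≤ ProbabilityTheory.cdf μ (x m + y / ε) + y) : bestError ε μ (m + 1) ≤ y := by
  set F := ProbabilityTheory.cdf μ with hF
  have hFm : Monotone F := ProbabilityTheory.monotone_cdf μ
  set P : ℕ → ℝ := fun j => min 1 (F (x j + y / ε) + y) with hP
  set Q : ℕ → ℝ := fun j => Nat.casesOn j 0 P with hQ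
  have hP0 : ∀ j, 0 ≤ P j := fun j =>
    le_min zero_le_one (add_nonneg (ProbabilityTheory.cdf_nonneg μ _) hy.le)
  have hPm : Monotone P := fun i j hij =>
    min_le_min le_rfl (by
      have := hFm (show x i + y / ε ≤ x j + y / ε by linarith [hx hij])
      linarith)
  have hPlast : P m = 1 := min_eq_left hright
  have hQm : ∀ j, Q j ≤ Q (j + 1) := fun j => by
    cases j with
    | zero => exact hP0 0
    | succ j => exact hPm (Nat.le_succ j)
  set p : Fin (m + 1) → ℝ := fun j => Q (j + 1) - Q j with hp
  have hpw : p ∈ weights (m + 1) := by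
    refine ⟨fun j => sub_nonneg.2 (hQm j), ?_⟩
    rw [Fin.sum_univ_eq_sum_range (fun j => Q (j + 1) - Q j), Finset.sum_range_sub]
    simp [hQ, hPlast]
  have hcdf : ∀ t, ∃ k ≤ m + 1, (∀ j < m + 1, x j ≤ t ↔ j < k) ∧
      ProbabilityTheory.cdf (atomicMeasure (fun j : Fin (m + 1) => x j) p) t = Q k := by
    intro t
    obtain ⟨k, hk, hk'⟩ := exists_forall_le_iff_lt hx t (m + 1)
    refine ⟨k, hk, hk', ?_⟩
    rw [cdf_atomicMeasure hpw,
      Fin.sum_univ_eq_sum_range (fun j => if x j ≤ t then Q (j + 1) - Q j else 0),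
      ← Finset.sum_filter]
    have : (Finset.range (m + 1)).filter (fun j => x j ≤ t) = Finset.range k := by
      ext j
      simp only [Finset.mem_filter, Finset.mem_range]
      exact ⟨fun h => (hk' j h.1).1 h.2, fun h => ⟨by omega, (hk' j (by omega)).2 h⟩⟩
    rw [this, Finset.sum_range_sub]
    simp [hQ]
  have hle : levyDist ε μ (atomicMeasure (fun j : Fin (m + 1) => x j) p) ≤ y := by
    refine levyDist_le hy fun t => ?_
    obtain ⟨k, hk, hk', hcdf⟩ := hcdf t
    rw [hcdf]
    rcases k with _ | j
    · have ht : t < x 0 := not_le.1 fun h => absurd ((hk' 0 (by omega)).1 h) (by omega)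
      have h1 := hFm.leftLim (show t - y / ε ≤ x 0 - y / ε by linarith)
      have h2 := ProbabilityTheory.cdf_nonneg μ (t + y / ε)
      exact ⟨show _ ≤ (0 : ℝ) by linarith, show (0 : ℝ) ≤ _ by linarith⟩
    · have hj : x j ≤ t := (hk' j (by omega)).2 (by omega)
      change _ ≤ P j ∧ P j ≤ _
      refine ⟨?_, (min_le_right _ _).trans ?_⟩
      · have h1 := leftLim_cdf_le_one μ (t - y / ε)
        rcases Nat.lt_or_ge j m with hjm | hjm
        · have ht : t < x (j + 1) :=
            not_le.1 fun h => absurd ((hk' (j + 1) (by omega)).1 h) (by omega)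
          have h2 := hFm.leftLim (show t - y / ε ≤ x (j + 1) - y / ε by linarith)
          have h3 := hgap j
          unfold GapBound at h3
          exact le_min (by linarith) (by linarith)
        · obtain rfl : j = m := by omega
          rw [hPlast]
          linarith
      · have := hFm (show x j + y / ε ≤ t + y / ε by linarith)
        linarith
  unfold bestError
  refine le_trans (csInf_le ⟨0, ?_⟩ ?_) hle
  · rintro d ⟨_, _, _, _, rfl⟩
    exact levyDist_nonneg _ _ _
  · exact ⟨fun j : Fin (m + 1) => x j, fun i j hij => hx hij, p, hpw, rfl⟩

theorem exists_levyDist_lt_of_bestErrorGiven_lt {ε : ℝ} {μ : Measure ℝ} {n : ℕ} (hn : 0 < n)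
    {x : Fin n → ℝ} {y : ℝ} (h : bestErrorGiven ε μ x < y) :
    ∃ p ∈ weights n, levyDist ε μ (atomicMeasure x p) < y := by
  have hne : {d : ℝ | ∃ p ∈ weights n, d = levyDist ε μ (atomicMeasure x p)}.Nonempty := by
    refine ⟨_, fun j => if j = ⟨0, hn⟩ then 1 else 0, ⟨fun j => ?_, by simp⟩, rfl⟩
    dsimp only
    split_ifs <;> norm_num
  obtain ⟨_, ⟨p, hp, rfl⟩, hlt⟩ := exists_lt_of_csInf_lt hne h
  exact ⟨p, hp, hlt⟩

theorem bestError_nonneg (ε : ℝ) (μ : Measure ℝ) (n : ℕ) : 0 ≤ bestError ε μ n := by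
  refine Real.sInf_nonneg ?_
  rintro d ⟨_, _, _, _, rfl⟩
  exact levyDist_nonneg _ _ _

/-! ### Chains of gaps -/

/-- `GapChain ε μ y a b n`: there are points `a = x₀ ≤ x₁ ≤ … ≤ xₙ = b` all of whose `n`
consecutive gaps satisfy `GapBound`. -/
inductive GapChain (ε : ℝ) (μ : Measure ℝ) (y : ℝ) : ℝ → ℝ → ℕ → Prop
  | refl (a : ℝ) : GapChain ε μ y a a 0
  | cons {a b c : ℝ} {n : ℕ} : a ≤ b → GapBound ε μ y a b → GapChain ε μ y b c n →
      GapChain ε μ y a c (n + 1)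

theorem GapChain.trans {ε : ℝ} {μ : Measure ℝ} {y a b c : ℝ} {n m : ℕ}
    (h : GapChain ε μ y a b n) (h' : GapChain ε μ y b c m) : GapChain ε μ y a c (n + m) := by
  induction h with
  | refl a => simpa using h'
  | cons hab hgap _ ih =>
    rw [Nat.add_right_comm]
    exact GapChain.cons hab hgap (ih h')

theorem GapChain.exists_seq {ε : ℝ} (hε : 0 < ε) {μ : Measure ℝ} {y : ℝ} (hy : 0 ≤ y) {a b : ℝ}
    {n : ℕ} (h : GapChain ε μ y a b n) :
    ∃ x : ℕ → ℝ, Monotone x ∧ x 0 = a ∧ (∀ i ≥ n, x i = b) ∧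
      ∀ i, GapBound ε μ y (x i) (x (i + 1)) := by
  induction h with
  | refl a =>
    exact ⟨fun _ => a, monotone_const, rfl, fun _ _ => rfl, fun _ => gapBound_self hε μ hy a⟩
  | @cons a b c n hab hgap _ ih =>
    obtain ⟨x, hx, hx0, hxn, hxg⟩ := ih
    refine ⟨fun i => Nat.casesOn i a x, monotone_nat_of_le_succ fun i => ?_, rfl, fun i hi => ?_,
      fun i => ?_⟩
    · rcases i with _ | i
      · exact hab.trans_eq hx0.symm
      · exact hx (Nat.le_succ i)
    · rcases i with _ | i
      · omega
      · exact hxn i (by omega)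
    · rcases i with _ | i
      · change GapBound ε μ y a (x 0)
        rwa [hx0]
      · exact hxg i

/-- If `(a, b)` is too heavy for a single gap, then there is a gap starting at `a` that satisfies
`GapBound` and is heavy enough to reach the critical mass `2 y` once its right end is included. -/
theorem exists_critical_gap {ε : ℝ} {μ : Measure ℝ} [IsProbabilityMeasure μ] {y : ℝ}
    (hy : 0 < y) {a b : ℝ} (h : ¬ GapBound ε μ y a b) :
    ∃ b' ≤ b, a + 2 * (y / ε) ≤ b' ∧ GapBound ε μ y a b' ∧
      2 * y ≤ μ.real (Ioc (a + y / ε) (b' - y / ε)) := by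
  set F := ProbabilityTheory.cdf μ with hF
  have hFm : Monotone F := ProbabilityTheory.monotone_cdf μ
  set S : Set ℝ := {t | F (a + y / ε) + 2 * y ≤ F t} with hS
  have hbdd : ∀ t ∈ S, a + y / ε ≤ t := by
    intro t ht
    by_contra! hlt
    have := hFm hlt.le
    have : F (a + y / ε) + 2 * y ≤ F t := ht
    linarith
  have hSne : ∃ t ∈ S, t < b - y / ε := by
    have h1 : F (a + y / ε) + 2 * y < Function.leftLim F (b - y / ε) := not_le.1 h
    have h2 := (hFm.tendsto_leftLim (b - y / ε)).eventually_const_lt h1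
    obtain ⟨t, ht, ht'⟩ := (h2.and self_mem_nhdsWithin).exists
    exact ⟨t, ht.le, ht'⟩
  have hBdd : BddBelow S := ⟨_, hbdd⟩
  have hne : S.Nonempty := hSne.imp fun _ h => h.1
  set s := sInf S with hs
  have hsS : F (a + y / ε) + 2 * y ≤ F s := by
    have hcont : Tendsto F (𝓝[>] s) (𝓝 (F s)) :=
      ((F.right_continuous s).mono Ioi_subset_Ici_self)
    refine ge_of_tendsto hcont ?_
    filter_upwards [self_mem_nhdsWithin] with t ht
    obtain ⟨u, hu, hut⟩ := exists_lt_of_csInf_lt hne ht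
    exact le_trans hu (hFm hut.le)
  have hleft : Function.leftLim F s ≤ F (a + y / ε) + 2 * y := by
    refine le_of_tendsto (hFm.tendsto_leftLim s) ?_
    filter_upwards [self_mem_nhdsWithin] with t ht
    exact (not_le.1 fun h' => notMem_of_lt_csInf ht hBdd h').le
  have has : a + y / ε ≤ s := le_csInf hne hbdd
  refine ⟨s + y / ε, ?_, by linarith, ?_, ?_⟩
  · obtain ⟨t, ht, ht'⟩ := hSne
    linarith [csInf_le hBdd ht]
  · unfold GapBound
    rwa [add_sub_cancel_right]
  · rw [add_sub_cancel_right, measureReal_def, ← ProbabilityTheory.measure_cdf μ,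
      StieltjesFunction.measure_Ioc, ENNReal.toReal_ofReal] <;> linarith

/-- Greedy choice of the atoms in `[A, B]`: if every critical gap costs at least `y` in terms of an
additive interval function `K`, then `K A B / y + 1` gaps suffice. -/
theorem exists_gapChain {ε : ℝ} (hε : 0 < ε) {μ : Measure ℝ} [IsProbabilityMeasure μ] {y : ℝ}
    (hy : 0 < y) {K : ℝ → ℝ → ℝ} (hK0 : ∀ a b, 0 ≤ K a b)
    (hKadd : ∀ a b c, a ≤ b → b ≤ c → K a b + K b c = K a c) {A B : ℝ} (hAB : A ≤ B)
    (hK : ∀ a b, A ≤ a → b ≤ B → a + 2 * (y / ε) ≤ b →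
      2 * y ≤ μ.real (Ioc (a + y / ε) (b - y / ε)) → y ≤ K a b) :
    ∃ n : ℕ, GapChain ε μ y A B n ∧ n * y ≤ K A B + y := by
  have hd : 0 < 2 * (y / ε) := by positivity
  -- Every critical gap has length at least `2 y / ε`, which bounds the number of steps.
  obtain ⟨k, hk⟩ := exists_nat_ge ((B - A) / (2 * (y / ε)))
  rw [div_le_iff₀ hd] at hk
  induction k generalizing A with
  | zero =>
    obtain rfl : A = B := le_antisymm hAB (by simp at hk; linarith)
    exact ⟨0, GapChain.refl A, by have := hK0 A A; simp; linarith⟩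
  | succ k ih =>
    by_cases h : GapBound ε μ y A B
    · exact ⟨1, GapChain.cons hAB h (GapChain.refl B), by have := hK0 A B; simp; linarith⟩
    · obtain ⟨b, hbB, hab, hgap, hmass⟩ := exists_critical_gap hy h
      have hAb : A ≤ b := by linarith
      push_cast at hk
      obtain ⟨n, hn, hny⟩ := ih hbB (fun a c ha hc => hK a c (hAb.trans ha) hc)
        (by linarith)
      refine ⟨n + 1, GapChain.cons hAb hgap hn, ?_⟩
      have h1 := hK A b le_rfl hbB hab hmass
      have h2 := hKadd A b B hAb hbB
      push_cast
      linarith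

/-! ### Partitions -/

/-- A property of intervals that is stable under concatenation holds for `[a, b]` if it holds for
every interval inside a member of an open cover. -/
theorem interval_induction {Q : ℝ → ℝ → Prop} (hrefl : ∀ a, Q a a)
    (htrans : ∀ a b c, a ≤ b → b ≤ c → Q a b → Q b c → Q a c) {ι : Type*} {U : ι → Set ℝ}
    (hU : ∀ i, IsOpen (U i)) {a b : ℝ} (hab : a ≤ b)
    (hcover : ∀ t ∈ Icc a b, ∃ i, t ∈ U i)
    (hpiece : ∀ i a b, a ≤ b → Icc a b ⊆ U i → Q a b) : Q a b := by
  obtain ⟨t, ht0, htm, ⟨m, hm⟩, ht⟩ := exists_monotone_Icc_subset_open_cover_Icc hab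
    (c := fun i => (Subtype.val : Icc a b → ℝ) ⁻¹' U i)
    (fun i => (hU i).preimage continuous_subtype_val)
    (fun s _ => by simpa using hcover s s.2)
  have key : ∀ k, Q (t 0) (t k) := by
    intro k
    induction k with
    | zero => exact hrefl _
    | succ k ih =>
      refine htrans _ _ _ (htm (Nat.zero_le k)) (htm (Nat.le_succ k)) ih ?_
      obtain ⟨i, hi⟩ := ht k
      refine hpiece i _ _ (htm (Nat.le_succ k)) fun s hs => ?_
      exact hi (show (⟨s, (t k).2.1.trans hs.1, hs.2.trans (t (k + 1)).2.2⟩ : Icc a b)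
        ∈ Icc (t k) (t (k + 1)) from hs)
  have := key m
  rwa [ht0, hm m le_rfl] at this

/-! ### The absolutely continuous part -/

section Density

variable (μ : Measure ℝ)

theorem measurable_acDensity : Measurable (acDensity μ) :=
  (Measure.measurable_rnDeriv _ _).ennreal_toReal

theorem acDensity_nonneg (t : ℝ) : 0 ≤ acDensity μ t := ENNReal.toReal_nonneg

theorem measurable_pointRate_acDensity (ε : ℝ) :
    Measurable fun t => pointRate ε (acDensity μ t) := by
  have h : Measurable (pointRate ε) := by unfold pointRate Omega; fun_prop
  exact h.comp (measurable_acDensity μ)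

variable [IsFiniteMeasure μ]

instance isFiniteMeasure_acPart : IsFiniteMeasure (acPart μ) :=
  isFiniteMeasure_of_le μ (Measure.withDensity_rnDeriv_le μ volume)

theorem integrable_acDensity : Integrable (acDensity μ) :=
  Measure.integrable_toReal_rnDeriv

theorem setIntegral_acDensity (A : Set ℝ) : ∫ t in A, acDensity μ t = (acPart μ).real A :=
  Measure.setIntegral_toReal_rnDeriv (withDensity_absolutelyContinuous _ _) A

theorem measureReal_eq_singularPart_add (A : Set ℝ) :
    μ.real A = (μ.singularPart volume).real A + ∫ t in A, acDensity μ t := by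
  rw [setIntegral_acDensity, acPart, ← measureReal_add_apply, Measure.singularPart_add_rnDeriv]

theorem integrable_pointRate_acDensity {ε : ℝ} (hε : 0 < ε) :
    Integrable fun t => pointRate ε (acDensity μ t) := by
  refine (integrable_acDensity μ).mono' (measurable_pointRate_acDensity μ ε).aestronglyMeasurable ?_
  refine ae_of_all _ fun t => ?_
  have h0 := acDensity_nonneg μ t
  rw [Real.norm_of_nonneg (pointRate_nonneg hε h0)]
  linarith [pointRate_le_half hε h0]

/-- The density is approximated in `L¹` by nonnegative continuous functions with compact
support. -/
theorem exists_continuous_approx_acDensity {η : ℝ} (hη : 0 < η) :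
    ∃ g : ℝ → ℝ, Continuous g ∧ HasCompactSupport g ∧ (∀ t, 0 ≤ g t) ∧
      Integrable (fun t => |acDensity μ t - g t|) ∧ ∫ t, |acDensity μ t - g t| ≤ η := by
  obtain ⟨g, hgs, hgη, hgc, hgi⟩ :=
    (integrable_acDensity μ).exists_hasCompactSupport_integral_sub_le hη
  refine ⟨fun t => |g t|, hgc.abs, hgs.comp_left abs_zero, fun t => abs_nonneg _,
    ((integrable_acDensity μ).sub hgi.abs).abs, le_trans ?_ hgη⟩
  refine integral_mono ((integrable_acDensity μ).sub hgi.abs).abs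
    ((integrable_acDensity μ).sub hgi).norm fun t => ?_
  have := abs_abs_sub_abs_le (acDensity μ t) (g t)
  rwa [abs_of_nonneg (acDensity_nonneg μ t)] at this

end Density

theorem setIntegral_Ioc_add {H : ℝ → ℝ} {a b c : ℝ} (hab : a ≤ b) (hbc : b ≤ c)
    (h : IntegrableOn H (Ioc a c)) :
    (∫ t in Ioc a b, H t) + ∫ t in Ioc b c, H t = ∫ t in Ioc a c, H t := by
  rw [← Ioc_union_Ioc_eq_Ioc hab hbc, setIntegral_union (Ioc_disjoint_Ioc_of_le le_rfl)
    measurableSet_Ioc (h.mono_set (Ioc_subset_Ioc_right hbc))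
    (h.mono_set (Ioc_subset_Ioc_left hab))]

theorem setIntegral_Ioc_const {a b : ℝ} (hab : a ≤ b) (c : ℝ) :
    ∫ _ in Ioc a b, c = c * (b - a) := by
  rw [setIntegral_const, Real.volume_real_Ioc_of_le hab, smul_eq_mul, mul_comm]

/-! ### The number of atoms in an interval is at least the integral of the rate -/

/-- The number of coordinates of `x` in the open interval `(a, b)`. -/
noncomputable def countIoo {n : ℕ} (x : Fin n → ℝ) (a b : ℝ) : ℕ := {j | x j ∈ Ioo a b}.ncard

theorem countIoo_add_le {n : ℕ} (x : Fin n → ℝ) {a b c : ℝ} (hab : a ≤ b) (hbc : b ≤ c) :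
    countIoo x a b + countIoo x b c ≤ countIoo x a c := by
  unfold countIoo
  rw [← ncard_union_eq]
  · refine ncard_le_ncard ?_ (toFinite _)
    rintro j (h | h)
    · exact ⟨h.1, h.2.trans_le hbc⟩
    · exact ⟨hab.trans_lt h.1, h.2⟩
  · rw [Set.disjoint_left]
    intro j h h'
    exact lt_asymm h.2 h'.1

theorem le_countIoo_mul {n : ℕ} (x : Fin n → ℝ) {y : ℝ} {K : ℝ → ℝ → ℝ}
    (hKadd : ∀ a b c, a ≤ b → b ≤ c → K a b + K b c = K a c) {A B : ℝ} (hAB : A ≤ B)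
    (hK : ∀ a b, A ≤ a → a ≤ b → b ≤ B → (∀ j, x j ∉ Ioo a b) → K a b ≤ y) :
    K A B ≤ (countIoo x A B + 1) * y := by
  induction h : countIoo x A B using Nat.strong_induction_on generalizing A with
  | _ N ih =>
    subst h
    rcases Set.eq_empty_or_nonempty {j | x j ∈ Ioo A B} with h0 | hne
    · have h1 := hK A B le_rfl hAB le_rfl fun j hj => h0.subset hj
      have h2 : countIoo x A B = 0 := by rw [countIoo, h0, ncard_empty]
      rw [h2]
      simpa using h1
    · obtain ⟨j, hj, hmin⟩ := exists_min_image {j | x j ∈ Ioo A B} x (toFinite _) hne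
      have hlt : countIoo x (x j) B < countIoo x A B := by
        refine ncard_lt_ncard (ssubset_iff_of_subset ?_ |>.2 ⟨j, hj, ?_⟩) (toFinite _)
        · exact fun i hi => ⟨hj.1.trans hi.1, hi.2⟩
        · exact fun h => lt_irrefl _ h.1
      have hy : K A (x j) ≤ y := by
        refine hK _ _ le_rfl hj.1.le hj.2.le fun i hi => ?_
        exact absurd (hmin i ⟨hi.1, hi.2.trans hj.2⟩) (not_le.2 hi.2)
      have h3 := ih _ hlt hj.2.le (fun a b ha => hK a b (hj.1.le.trans ha)) rfl
      have h4 := hKadd A (x j) B hj.1.le hj.2.le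
      have hy0 : 0 ≤ y := by
        have h5 := hK A A le_rfl le_rfl hAB fun j hj => by simp at hj
        have h6 := hKadd A A A le_rfl le_rfl
        linarith
      have h7 : ((countIoo x (x j) B : ℝ) + 1) * y ≤ countIoo x A B * y :=
        mul_le_mul_of_nonneg_right (by exact_mod_cast hlt) hy0
      linarith

/-- A gap satisfying `GapBound` accounts for at most `y` of the integral of the rate, up to the
`L¹` distance of the density from a constant `c` on the gap. -/
theorem setIntegral_le_of_gapBound {ε : ℝ} (hε : 0 < ε) {μ : Measure ℝ} [IsProbabilityMeasure μ]
    {y : ℝ} (hy : 0 < y) {a b c : ℝ} (hab : a ≤ b) (hc : 0 ≤ c) (hgap : GapBound ε μ y a b) :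
    ∫ t in Ioc a b, (pointRate ε (acDensity μ t) - |acDensity μ t - c|) ≤ y := by
  have hf := integrable_acDensity μ
  have hci : ∀ c' : ℝ, IntegrableOn (fun _ => c') (Ioc a b) :=
    fun c' => integrableOn_const measure_Ioc_lt_top.ne
  have hfc : IntegrableOn (fun t => |acDensity μ t - c|) (Ioc a b) :=
    (hf.integrableOn.sub (hci c)).abs
  set τ := ∫ t in Ioc a b, |acDensity μ t - c| with hτ
  have hτ0 : 0 ≤ τ := integral_nonneg fun t => abs_nonneg _
  have h1 : c * ((b - a) - 2 * (y / ε)) ≤ 2 * y + τ := by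
    rcases le_or_gt ((b - a) - 2 * (y / ε)) 0 with hL | hL
    · have := mul_nonpos_of_nonneg_of_nonpos hc hL
      linarith
    · have hd : 0 < y / ε := div_pos hy hε
      have hsub : Ioo (a + y / ε) (b - y / ε) ⊆ Ioc a b := fun t ht =>
        ⟨by linarith [ht.1], by linarith [ht.2]⟩
      have hμ : μ.real (Ioo (a + y / ε) (b - y / ε)) ≤ 2 * y := by
        rw [measureReal_def, ← ProbabilityTheory.measure_cdf μ, StieltjesFunction.measure_Ioo]
        refine ENNReal.toReal_le_of_le_ofReal (by positivity) (ENNReal.ofReal_le_ofReal ?_)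
        unfold GapBound at hgap
        linarith
      have hfμ : ∫ t in Ioo (a + y / ε) (b - y / ε), acDensity μ t ≤ 2 * y := by
        have := measureReal_eq_singularPart_add μ (Ioo (a + y / ε) (b - y / ε))
        have h0 : 0 ≤ (μ.singularPart volume).real (Ioo (a + y / ε) (b - y / ε)) :=
          measureReal_nonneg
        linarith
      have hsub' : ∫ t in Ioo (a + y / ε) (b - y / ε), |acDensity μ t - c| ≤ τ :=
        setIntegral_mono_set hfc (ae_of_all _ fun t => abs_nonneg _) hsub.eventuallyLE
      have hconst : ∫ _ in Ioo (a + y / ε) (b - y / ε), c = c * ((b - a) - 2 * (y / ε)) := by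
        rw [setIntegral_const, Real.volume_real_Ioo_of_le (by linarith), smul_eq_mul]
        ring
      have hmono : ∫ _ in Ioo (a + y / ε) (b - y / ε), c ≤
          ∫ t in Ioo (a + y / ε) (b - y / ε), (acDensity μ t + |acDensity μ t - c|) := by
        refine integral_mono ((hci c).mono_set hsub)
          (hf.integrableOn.add (hfc.mono_set hsub)) fun t => ?_
        have := neg_abs_le (acDensity μ t - c)
        dsimp only
        linarith
      rw [integral_add hf.integrableOn (hfc.mono_set hsub)] at hmono
      linarith
  have h2 := pointRate_mul_le hε hc hτ0 h1
  have h3 : ∫ t in Ioc a b, (pointRate ε (acDensity μ t) - |acDensity μ t - c|) ≤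
      ∫ t in Ioc a b, (pointRate ε c - |acDensity μ t - c| / 2) := by
    refine integral_mono ((integrable_pointRate_acDensity μ hε).integrableOn.sub hfc)
      ((hci _).sub (hfc.div_const 2)) fun t => ?_
    have := pointRate_le_add hε (acDensity_nonneg μ t) hc
    dsimp only
    linarith
  rw [integral_sub (hci _) (hfc.div_const 2), setIntegral_Ioc_const hab, integral_div] at h3
  linarith

/-- If all gaps between the points of `x` satisfy `GapBound`, then `(a, b)` contains asymptotically
at least `1 / y` times the integral of the rate over `(a, b)` of these points. -/
theorem setIntegral_pointRate_le_countIoo {ε : ℝ} (hε : 0 < ε) (μ : Measure ℝ)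
    [IsProbabilityMeasure μ] {a b : ℝ} (hab : a ≤ b) {η : ℝ} (hη : 0 < η) :
    ∃ M : ℝ, ∀ (n : ℕ) (x : Fin n → ℝ) (y : ℝ), 0 < y →
      (∀ a b, a ≤ b → (∀ j, x j ∉ Ioo a b) → GapBound ε μ y a b) →
      (∫ t in Ioc a b, pointRate ε (acDensity μ t)) - η ≤ (countIoo x a b + M) * y := by
  obtain ⟨g, hgc, -, hg0, hgi, hgη⟩ := exists_continuous_approx_acDensity μ (half_pos hη)
  have hba : 0 < b - a + 1 := by linarith
  set ρ := η / 2 / (b - a + 1) with hρ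
  have hρ0 : 0 < ρ := by positivity
  have hh := integrable_pointRate_acDensity μ hε
  set H : ℝ → ℝ := fun t => pointRate ε (acDensity μ t) - |acDensity μ t - g t| - ρ with hH
  have hci : ∀ a b : ℝ, IntegrableOn (fun _ => ρ) (Ioc a b) :=
    fun a b => integrableOn_const measure_Ioc_lt_top.ne
  have hHi : ∀ a b, IntegrableOn H (Ioc a b) := fun a b =>
    (hh.integrableOn.sub hgi.integrableOn).sub (hci a b)
  have hadd : ∀ a b c, a ≤ b → b ≤ c →
      (∫ t in Ioc a b, H t) + ∫ t in Ioc b c, H t = ∫ t in Ioc a c, H t :=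
    fun a b c hab hbc => setIntegral_Ioc_add hab hbc (hHi a c)
  have key : ∃ M : ℝ, ∀ (n : ℕ) (x : Fin n → ℝ) (y : ℝ), 0 < y →
      (∀ a b, a ≤ b → (∀ j, x j ∉ Ioo a b) → GapBound ε μ y a b) →
      ∫ t in Ioc a b, H t ≤ (countIoo x a b + M) * y := by
    refine interval_induction (Q := fun a b => ∃ M : ℝ, ∀ (n : ℕ) (x : Fin n → ℝ) (y : ℝ),
      0 < y → (∀ a b, a ≤ b → (∀ j, x j ∉ Ioo a b) → GapBound ε μ y a b) →
      ∫ t in Ioc a b, H t ≤ (countIoo x a b + M) * y)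
      (U := fun c : NNReal => {t | |g t - c| < ρ}) ?_ ?_ ?_ hab ?_ ?_
    · refine fun a => ⟨0, fun n x y hy _ => ?_⟩
      simp only [Ioc_self, setIntegral_empty, add_zero]
      positivity
    · rintro a b c hab hbc ⟨M, hM⟩ ⟨M', hM'⟩
      refine ⟨M + M', fun n x y hy hx => ?_⟩
      have h1 := hM n x y hy hx
      have h2 := hM' n x y hy hx
      have h3 : ((countIoo x a b : ℝ) + countIoo x b c) * y ≤ countIoo x a c * y :=
        mul_le_mul_of_nonneg_right (by exact_mod_cast countIoo_add_le x hab hbc) hy.le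
      rw [← hadd a b c hab hbc]
      linarith
    · exact fun c => isOpen_lt (by fun_prop) continuous_const
    · exact fun t _ => ⟨⟨g t, hg0 t⟩, by
        change |g t - g t| < ρ
        simpa using hρ0⟩
    · intro c a b hab hsub
      refine ⟨1, fun n x y hy hx => ?_⟩
      refine le_countIoo_mul x (K := fun a b => ∫ t in Ioc a b, H t) hadd hab ?_
      intro a' b' ha' hab' hb' hno
      refine le_trans ?_ (setIntegral_le_of_gapBound hε hy hab' c.2 (hx a' b' hab' hno))
      refine setIntegral_mono_on (hHi a' b') ?_ measurableSet_Ioc fun t ht => ?_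
      · exact hh.integrableOn.sub ((integrable_acDensity μ).integrableOn.sub
          (integrableOn_const measure_Ioc_lt_top.ne)).abs
      · have h1 : |g t - c| < ρ := hsub ⟨ha'.trans ht.1.le, ht.2.trans hb'⟩
        have h2 := abs_sub_le (acDensity μ t) (g t) c
        simp only [hH, NNReal.val_eq_coe]
        linarith
  obtain ⟨M, hM⟩ := key
  refine ⟨M, fun n x y hy hx => le_trans ?_ (hM n x y hy hx)⟩
  have h1 : ∫ t in Ioc a b, H t = (∫ t in Ioc a b, pointRate ε (acDensity μ t)) -
      (∫ t in Ioc a b, |acDensity μ t - g t|) - ρ * (b - a) := by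
    have hd : IntegrableOn (fun t => pointRate ε (acDensity μ t) - |acDensity μ t - g t|)
        (Ioc a b) := hh.integrableOn.sub hgi.integrableOn
    rw [← setIntegral_Ioc_const hab, ← integral_sub hh.integrableOn hgi.integrableOn,
      ← integral_sub hd (hci a b)]
  have h2 : ∫ t in Ioc a b, |acDensity μ t - g t| ≤ η / 2 :=
    (setIntegral_le_integral hgi (ae_of_all _ fun t => abs_nonneg _)).trans hgη
  have h3 : ρ * (b - a) ≤ η / 2 := by
    rw [hρ, div_mul_eq_mul_div, div_le_iff₀ hba]
    nlinarith
  linarith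

/-! ### The minimal error is at most the integral of the rate, divided by the number of atoms -/

/-- A gap of critical mass accounts for at least `y` of the integral of the rate, up to the `L¹`
distance of the density from a constant `c` and the mass of the singular part on the gap. -/
theorem le_setIntegral_of_critical {ε : ℝ} (hε : 0 < ε) {μ : Measure ℝ} [IsFiniteMeasure μ]
    {y : ℝ} (hy : 0 < y) {a b c : ℝ} (hc : 0 ≤ c) (hab : a + 2 * (y / ε) ≤ b)
    (hmass : 2 * y ≤ μ.real (Ioc (a + y / ε) (b - y / ε))) :
    y ≤ (∫ t in Ioc a b, (pointRate ε (acDensity μ t) + |acDensity μ t - c|)) +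
      (μ.singularPart volume).real (Ioc a b) / 2 := by
  have hd : 0 < y / ε := div_pos hy hε
  have hab' : a ≤ b := by linarith
  have hf := integrable_acDensity μ
  have hci : ∀ c' : ℝ, IntegrableOn (fun _ => c') (Ioc a b) :=
    fun c' => integrableOn_const measure_Ioc_lt_top.ne
  have hfc : IntegrableOn (fun t => |acDensity μ t - c|) (Ioc a b) :=
    (hf.integrableOn.sub (hci c)).abs
  set τ := ∫ t in Ioc a b, |acDensity μ t - c| with hτ
  have hτ0 : 0 ≤ τ := integral_nonneg fun t => abs_nonneg _
  set σ := (μ.singularPart volume).real (Ioc a b) with hσ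
  have hσ0 : 0 ≤ σ := measureReal_nonneg
  have hsub : Ioc (a + y / ε) (b - y / ε) ⊆ Ioc a b :=
    Ioc_subset_Ioc (by linarith) (by linarith)
  have h1 : 2 * y ≤ c * ((b - a) - 2 * (y / ε)) + (τ + σ) := by
    rw [measureReal_eq_singularPart_add μ] at hmass
    have hσ' : (μ.singularPart volume).real (Ioc (a + y / ε) (b - y / ε)) ≤ σ :=
      measureReal_mono hsub
    have hsub' : ∫ t in Ioc (a + y / ε) (b - y / ε), |acDensity μ t - c| ≤ τ :=
      setIntegral_mono_set hfc (ae_of_all _ fun t => abs_nonneg _) hsub.eventuallyLE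
    have hmono : ∫ t in Ioc (a + y / ε) (b - y / ε), acDensity μ t ≤
        ∫ t in Ioc (a + y / ε) (b - y / ε), (c + |acDensity μ t - c|) := by
      refine integral_mono hf.integrableOn
        (((hci c).mono_set hsub).add (hfc.mono_set hsub)) fun t => ?_
      have := le_abs_self (acDensity μ t - c)
      dsimp only
      linarith
    rw [integral_add ((hci c).mono_set hsub) (hfc.mono_set hsub),
      setIntegral_Ioc_const (by linarith)] at hmono
    have : c * (b - y / ε - (a + y / ε)) = c * ((b - a) - 2 * (y / ε)) := by ring
    linarith
  have h2 := le_pointRate_mul hε hc (add_nonneg hτ0 hσ0) h1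
  have h3 : ∫ t in Ioc a b, (pointRate ε c - |acDensity μ t - c| / 2) ≤
      ∫ t in Ioc a b, pointRate ε (acDensity μ t) := by
    refine integral_mono ((hci _).sub (hfc.div_const 2))
      (integrable_pointRate_acDensity μ hε).integrableOn fun t => ?_
    have := pointRate_le_add hε hc (acDensity_nonneg μ t)
    rw [abs_sub_comm] at this
    dsimp only
    linarith
  rw [integral_sub (hci _) (hfc.div_const 2), setIntegral_Ioc_const hab', integral_div] at h3
  rw [integral_add (integrable_pointRate_acDensity μ hε).integrableOn hfc]
  linarith

/-- The singular part of `μ` is carried, up to mass `η`, by a Lebesgue null compact set. -/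
theorem exists_compact_singularPart (μ : Measure ℝ) [IsFiniteMeasure μ] {η : ℝ} (hη : 0 < η) :
    ∃ K : Set ℝ, IsCompact K ∧ volume K = 0 ∧ (μ.singularPart volume).real Kᶜ ≤ η := by
  obtain ⟨s, hs, hs0, hs1⟩ := Measure.mutuallySingular_singularPart μ volume
  obtain ⟨K, hKs, hK, hlt⟩ := hs.compl.exists_isCompact_lt_add
    (measure_ne_top (μ.singularPart volume) sᶜ) (ENNReal.ofReal_pos.2 hη).ne'
  refine ⟨K, hK, measure_mono_null hKs hs1, ?_⟩
  refine ENNReal.toReal_le_of_le_ofReal hη.le ?_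
  have huniv : (μ.singularPart volume) univ = (μ.singularPart volume) sᶜ := by
    rw [← measure_add_measure_compl hs, hs0, zero_add]
  rw [measure_compl hK.measurableSet (measure_ne_top _ _), huniv]
  exact tsub_le_iff_left.2 hlt.le

/-- For every error `y`, a bounded number of atoms more than `1 / y` times the integral of the rate
is enough to reach error `y`. -/
theorem exists_gapChain_le_integral {ε : ℝ} (hε : 0 < ε) (μ : Measure ℝ)
    [IsProbabilityMeasure μ] {η : ℝ} (hη : 0 < η) :
    ∃ M : ℝ, ∀ y : ℝ, 0 < y → ∃ (A B : ℝ) (n : ℕ), GapChain ε μ y A B n ∧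
      n * y ≤ (∫ t, pointRate ε (acDensity μ t)) + η + M * y ∧
      Function.leftLim (ProbabilityTheory.cdf μ) (A - y / ε) ≤ y ∧
      1 ≤ ProbabilityTheory.cdf μ (B + y / ε) + y := by
  have hη4 : 0 < η / 4 := by positivity
  have hh := integrable_pointRate_acDensity μ hε
  obtain ⟨g, hgc, hgs, hg0, hgi, hgη⟩ := exists_continuous_approx_acDensity μ hη4
  obtain ⟨K, hK, hK0, hKη⟩ := exists_compact_singularPart μ hη4
  obtain ⟨U, hKU, hU, hUη⟩ := K.exists_isOpen_lt_of_lt (μ := volume)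
    (ENNReal.ofReal (η / (2 * ε))) (by rw [hK0]; exact ENNReal.ofReal_pos.2 (by positivity))
  obtain ⟨R, hR⟩ := (hgs.isCompact.union hK).isBounded.subset_closedBall 0
  -- Outside `(-S, S)` both `g` and the compact carrier of the singular part vanish.
  obtain ⟨S, hS0, hRS⟩ : ∃ S, 0 < S ∧ R < S := ⟨max R 0 + 1, by positivity, by
    linarith [le_max_left R 0]⟩
  have hout : ∀ t, S ≤ |t| → g t = 0 ∧ t ∉ K := by
    intro t ht
    have : t ∉ tsupport g ∪ K := fun h => by
      have := hR h
      rw [mem_closedBall_zero_iff, Real.norm_eq_abs] at this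
      linarith
    exact ⟨image_eq_zero_of_notMem_tsupport fun h => this (Or.inl h), fun h => this (Or.inr h)⟩
  set V : Set ℝ := Ioo (-(S + 1)) (S + 1) with hV
  have hVvol : volume.real V = 2 * (S + 1) := by
    rw [hV, Real.volume_real_Ioo_of_le (by linarith)]
    ring
  set ρ := η / 4 / (2 * (S + 1)) with hρ
  have hρ0 : 0 < ρ := by positivity
  have hUr : volume.real U ≤ η / (2 * ε) := ENNReal.toReal_le_of_le_ofReal (by positivity) hUη.le
  have hiV : Integrable (V.indicator fun _ => ρ) :=
    (integrable_indicator_iff measurableSet_Ioo).2 (integrableOn_const measure_Ioo_lt_top.ne)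
  have hiU : Integrable (U.indicator fun _ => ε / 2) :=
    (integrable_indicator_iff hU.measurableSet).2
      (integrableOn_const (hUη.trans ENNReal.ofReal_lt_top).ne)
  set H : ℝ → ℝ := fun t => pointRate ε (acDensity μ t) + |acDensity μ t - g t| +
    V.indicator (fun _ => ρ) t + U.indicator (fun _ => ε / 2) t with hH
  have hHi : Integrable H := ((hh.add hgi).add hiV).add hiU
  have hnn1 : ∀ t, 0 ≤ pointRate ε (acDensity μ t) := fun t =>
    pointRate_nonneg hε (acDensity_nonneg μ t)
  have hnn2 : ∀ t, 0 ≤ V.indicator (fun _ => ρ) t := fun t =>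
    indicator_nonneg (fun _ _ => hρ0.le) t
  have hnn3 : ∀ t, 0 ≤ U.indicator (fun _ => ε / 2) t := fun t =>
    indicator_nonneg (fun _ _ => (half_pos hε).le) t
  have hH0 : ∀ t, 0 ≤ H t := fun t =>
    add_nonneg (add_nonneg (add_nonneg (hnn1 t) (abs_nonneg _)) (hnn2 t)) (hnn3 t)
  set σ := (μ.singularPart volume).restrict Kᶜ with hσ
  set cost : ℝ → ℝ → ℝ := fun a b => (∫ t in Ioc a b, H t) + σ.real (Ioc a b) / 2 with hcost
  have hcost0 : ∀ a b, 0 ≤ cost a b := fun a b =>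
    add_nonneg (integral_nonneg hH0) (div_nonneg measureReal_nonneg two_pos.le)
  have hadd : ∀ a b c, a ≤ b → b ≤ c → cost a b + cost b c = cost a c := by
    intro a b c hab hbc
    have h1 := setIntegral_Ioc_add hab hbc (hHi.integrableOn (s := Ioc a c))
    have h2 : σ.real (Ioc a c) = σ.real (Ioc a b) + σ.real (Ioc b c) := by
      rw [← Ioc_union_Ioc_eq_Ioc hab hbc,
        measureReal_union (Ioc_disjoint_Ioc_of_le le_rfl) measurableSet_Ioc]
    simp only [hcost]
    linarith
  have hσK : ∀ a b, Ioc a b ⊆ Kᶜ →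
      (μ.singularPart volume).real (Ioc a b) = σ.real (Ioc a b) := by
    intro a b h
    rw [hσ, measureReal_restrict_apply measurableSet_Ioc, inter_eq_left.2 h]
  have htotal : ∀ a b, cost a b ≤ (∫ t, pointRate ε (acDensity μ t)) + η := by
    intro a b
    have h1 : ∫ t in Ioc a b, H t ≤ ∫ t, H t :=
      setIntegral_le_integral hHi (ae_of_all _ hH0)
    have h2 : ∫ t, H t = (∫ t, pointRate ε (acDensity μ t)) + (∫ t, |acDensity μ t - g t|) +
        (∫ t, V.indicator (fun _ => ρ) t) + ∫ t, U.indicator (fun _ => ε / 2) t := by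
      have e1 : Integrable fun t => pointRate ε (acDensity μ t) + |acDensity μ t - g t| :=
        hh.add hgi
      have e2 : Integrable fun t => pointRate ε (acDensity μ t) + |acDensity μ t - g t| +
        V.indicator (fun _ => ρ) t := e1.add hiV
      rw [← integral_add hh hgi, ← integral_add e1 hiV, ← integral_add e2 hiU]
    have h3 : ∫ t, V.indicator (fun _ => ρ) t = η / 4 := by
      rw [integral_indicator measurableSet_Ioo, setIntegral_const, hVvol, smul_eq_mul, hρ]
      field_simp
    have h4 : ∫ t, U.indicator (fun _ => ε / 2) t ≤ η / 4 := by
      rw [integral_indicator hU.measurableSet, setIntegral_const, smul_eq_mul]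
      calc volume.real U * (ε / 2) ≤ η / (2 * ε) * (ε / 2) := by gcongr
        _ = η / 4 := by field_simp; norm_num
    have h5 : σ.real (Ioc a b) ≤ η / 4 := by
      rw [hσ, measureReal_restrict_apply measurableSet_Ioc]
      exact (measureReal_mono inter_subset_right).trans hKη
    simp only [hcost]
    linarith
  -- On an interval disjoint from `K` on which `g` is close to a constant, critical gaps are costly.
  have hregular : ∀ (c : ℝ), 0 ≤ c → ∀ y, 0 < y → ∀ a b, a + 2 * (y / ε) ≤ b →
      2 * y ≤ μ.real (Ioc (a + y / ε) (b - y / ε)) → Ioc a b ⊆ Kᶜ →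
      (∀ t ∈ Ioc a b, |g t - c| ≤ V.indicator (fun _ => ρ) t) → y ≤ cost a b := by
    intro c hc y hy a b hab hmass hKab hgV
    refine (le_setIntegral_of_critical hε hy hc hab hmass).trans ?_
    rw [hσK a b hKab]
    refine add_le_add ?_ le_rfl
    refine setIntegral_mono_on ?_ hHi.integrableOn measurableSet_Ioc fun t ht => ?_
    · exact hh.integrableOn.add ((integrable_acDensity μ).integrableOn.sub
        (integrableOn_const measure_Ioc_lt_top.ne)).abs
    · have h1 := hgV t ht
      have h2 := abs_sub_le (acDensity μ t) (g t) c
      have h3 := hnn3 t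
      simp only [hH]
      linarith
  -- On an interval inside `U`, the length alone is costly enough.
  have hsingular : ∀ y, 0 < y → ∀ a b, a + 2 * (y / ε) ≤ b → Ioc a b ⊆ U → y ≤ cost a b := by
    intro y hy a b hab hUab
    have hd : 0 < y / ε := div_pos hy hε
    have h1 : ∫ _ in Ioc a b, ε / 2 ≤ ∫ t in Ioc a b, H t := by
      refine setIntegral_mono_on (integrableOn_const measure_Ioc_lt_top.ne) hHi.integrableOn
        measurableSet_Ioc fun t ht => ?_
      have e1 := hnn1 t
      have e2 := hnn2 t
      have e3 := abs_nonneg (acDensity μ t - g t)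
      simp only [hH, indicator_of_mem (hUab ht)]
      linarith
    rw [setIntegral_Ioc_const (by linarith)] at h1
    have h2 : 0 ≤ σ.real (Ioc a b) := measureReal_nonneg
    have h3 : y = ε / 2 * (2 * (y / ε)) := by field_simp
    have h4 : ε / 2 * (2 * (y / ε)) ≤ ε / 2 * (b - a) := by gcongr; linarith
    simp only [hcost]
    linarith
  -- The central part `[-S, S]`, cut into finitely many pieces of one of the two kinds.
  have hcentre : ∃ M : ℝ, ∀ y : ℝ, 0 < y → ∃ n : ℕ, GapChain ε μ y (-S) S n ∧
      n * y ≤ cost (-S) S + M * y := by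
    refine interval_induction (Q := fun a b => ∃ M : ℝ, ∀ y : ℝ, 0 < y → ∃ n : ℕ,
      GapChain ε μ y a b n ∧ n * y ≤ cost a b + M * y)
      (U := fun i : Option NNReal => i.elim U fun c => {t | |g t - c| < ρ} ∩ Kᶜ ∩ V)
      ?_ ?_ ?_ (by linarith) ?_ ?_
    · exact fun a => ⟨0, fun y _ => ⟨0, GapChain.refl a, by simpa using hcost0 a a⟩⟩
    · rintro a b c hab hbc ⟨M, hM⟩ ⟨M', hM'⟩
      refine ⟨M + M', fun y hy => ?_⟩
      obtain ⟨n, hn, hn'⟩ := hM y hy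
      obtain ⟨m, hm, hm'⟩ := hM' y hy
      refine ⟨n + m, hn.trans hm, ?_⟩
      rw [← hadd a b c hab hbc]
      push_cast
      linarith
    · rintro (_ | c)
      · exact hU
      · exact ((isOpen_lt (by fun_prop) continuous_const).inter hK.isClosed.isOpen_compl).inter
          isOpen_Ioo
    · intro t ht
      by_cases htK : t ∈ K
      · exact ⟨none, hKU htK⟩
      · refine ⟨some ⟨g t, hg0 t⟩, ⟨?_, htK⟩, by linarith [ht.1], by linarith [ht.2]⟩
        change |g t - g t| < ρ
        simpa using hρ0
    · intro i a b hab hsub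
      refine ⟨1, fun y hy => ?_⟩
      rw [one_mul]
      refine exists_gapChain hε hy hcost0 hadd hab fun a' b' ha' hb' hlen hmass => ?_
      have hsub' : Ioc a' b' ⊆ Icc a b := fun t ht => ⟨ha'.trans ht.1.le, ht.2.trans hb'⟩
      rcases i with _ | c
      · exact hsingular y hy a' b' hlen (hsub'.trans hsub)
      · refine hregular c c.2 y hy a' b' hlen hmass (fun t ht => (hsub (hsub' ht)).1.2)
          fun t ht => ?_
        obtain ⟨⟨h1, -⟩, h2⟩ := hsub (hsub' ht)
        rw [indicator_of_mem h2]
        exact (show |g t - c| < ρ from h1).le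
  obtain ⟨M, hM⟩ := hcentre
  -- The two tails, which depend on `y`, need no partition.
  have htail : ∀ y, 0 < y → ∀ a b, a ≤ b → (∀ t ∈ Ioc a b, S ≤ |t|) →
      ∃ n : ℕ, GapChain ε μ y a b n ∧ n * y ≤ cost a b + y := by
    intro y hy a b hab hfar
    refine exists_gapChain hε hy hcost0 hadd hab fun a' b' ha' hb' hlen hmass => ?_
    have hsub : Ioc a' b' ⊆ Ioc a b := Ioc_subset_Ioc ha' hb'
    refine hregular 0 le_rfl y hy a' b' hlen hmass (fun t ht => (hout t (hfar t (hsub ht))).2)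
      fun t ht => ?_
    rw [(hout t (hfar t (hsub ht))).1]
    simpa using hnn2 t
  refine ⟨M + 2, fun y hy => ?_⟩
  have hd : 0 < y / ε := div_pos hy hε
  obtain ⟨A, hA, hAS⟩ := (((ProbabilityTheory.tendsto_cdf_atBot μ).eventually_lt_const hy).and
    (eventually_le_atBot (-S))).exists
  obtain ⟨B, hB, hBS⟩ := (((ProbabilityTheory.tendsto_cdf_atTop μ).eventually_const_lt
    (show 1 - y < 1 by linarith)).and (eventually_ge_atTop S)).exists
  obtain ⟨n₁, hn₁, hn₁'⟩ := htail y hy A (-S) hAS fun t ht => by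
    rw [abs_of_nonpos (by linarith [ht.2])]; linarith [ht.2]
  obtain ⟨n₂, hn₂, hn₂'⟩ := hM y hy
  obtain ⟨n₃, hn₃, hn₃'⟩ := htail y hy S B hBS fun t ht => by
    rw [abs_of_nonneg (by linarith [ht.1])]; exact ht.1.le
  refine ⟨A, B, n₁ + (n₂ + n₃), hn₁.trans (hn₂.trans hn₃), ?_, ?_, ?_⟩
  · have h1 := hadd A (-S) S hAS (by linarith)
    have h2 := hadd A S B (by linarith) hBS
    have h3 := htotal A B
    push_cast
    linarith
  · exact ((ProbabilityTheory.monotone_cdf μ).leftLim_le (by linarith)).trans hA.le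
  · have := ProbabilityTheory.monotone_cdf μ (show B ≤ B + y / ε by linarith)
    linarith

/-- The upper asymptotic bound for the minimal error with `n` atoms. -/
theorem eventually_bestError_le {ε : ℝ} (hε : 0 < ε) (μ : Measure ℝ) [IsProbabilityMeasure μ]
    {D : ℝ} (hD : ∫ t, pointRate ε (acDensity μ t) < D) :
    ∀ᶠ n : ℕ in atTop, bestError ε μ n ≤ D / n := by
  have hC0 : 0 ≤ ∫ t, pointRate ε (acDensity μ t) :=
    integral_nonneg fun t => pointRate_nonneg hε (acDensity_nonneg μ t)
  set C := ∫ t, pointRate ε (acDensity μ t) with hC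
  have hD0 : 0 < D := hC0.trans_lt hD
  set η := (D - C) / 2 with hη
  have hη0 : 0 < η := by rw [hη]; linarith
  obtain ⟨M, hM⟩ := exists_gapChain_le_integral hε μ hη0
  obtain ⟨N, hN⟩ := exists_nat_ge ((M + 1) * D / η)
  filter_upwards [eventually_ge_atTop (max N 1)] with n hn
  have hn1 : 1 ≤ n := (le_max_right _ _).trans hn
  obtain ⟨m, rfl⟩ : ∃ m, n = m + 1 := ⟨n - 1, by omega⟩
  have hm0 : (0 : ℝ) < (m + 1 : ℕ) := by positivity
  set y := D / (m + 1 : ℕ) with hy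
  have hy0 : 0 < y := div_pos hD0 hm0
  obtain ⟨A, B, k, hk, hky, hA, hB⟩ := hM y hy0
  obtain ⟨x, hx, hx0, hxk, hxg⟩ := hk.exists_seq hε hy0.le
  -- The gain `η` absorbs the bounded excess `M`, so that `k ≤ m`.
  have hkm : k ≤ m := by
    have hyD : y * (m + 1 : ℕ) = D := div_mul_cancel₀ _ hm0.ne'
    have hNm : (M + 1) * D / η ≤ (m + 1 : ℕ) :=
      hN.trans (by exact_mod_cast (le_max_left _ _).trans hn)
    have h1 : (M + 1) * y ≤ η := by
      rw [div_le_iff₀ hη0] at hNm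
      rw [hy, ← mul_div_assoc, div_le_iff₀ hm0]
      linarith
    have h2 : (k : ℝ) * y ≤ m * y := by
      push_cast at hyD
      have : C + η + η = D := by rw [hη]; ring
      nlinarith
    exact_mod_cast le_of_mul_le_mul_right h2 hy0
  exact bestError_le_of_gapBound μ hy0 hx m hxg (by rwa [hx0]) (by rwa [hxk m hkm])

/-! ### Convergence of the empirical distributions -/

theorem integral_pointRate_pos {ε : ℝ} (hε : 0 < ε) {μ : Measure ℝ} [IsFiniteMeasure μ]
    (hμ : acPart μ ≠ 0) : 0 < ∫ t, pointRate ε (acDensity μ t) := by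
  have hnn : ∀ t, 0 ≤ pointRate ε (acDensity μ t) := fun t =>
    pointRate_nonneg hε (acDensity_nonneg μ t)
  refine (integral_nonneg hnn).lt_of_ne' fun h0 => hμ ?_
  rw [integral_eq_zero_iff_of_nonneg hnn (integrable_pointRate_acDensity μ hε)] at h0
  have hf : acDensity μ =ᵐ[volume] 0 := by
    filter_upwards [h0] with t ht
    have h1 := acDensity_nonneg μ t
    simp only [Pi.zero_apply] at ht ⊢
    rw [pointRate_eq hε h1, div_eq_zero_iff] at ht
    rcases ht with ht | ht
    · exact (mul_eq_zero.1 ht).resolve_left hε.ne'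
    · linarith
  have h1 := setIntegral_acDensity μ univ
  rw [setIntegral_univ, integral_congr_ae hf] at h1
  simp only [Pi.zero_apply, integral_zero] at h1
  exact Measure.measure_univ_eq_zero.1 ((measureReal_eq_zero_iff).1 h1.symm)

theorem pointDistribution_eq {ε : ℝ} (hε : 0 < ε) (μ : Measure ℝ) :
    pointDistribution ε μ = volume.withDensity fun t =>
      ENNReal.ofReal (pointRate ε (acDensity μ t) / ∫ s, pointRate ε (acDensity μ s)) := by
  unfold pointDistribution pointRate
  congr 1
  funext t
  rw [integral_const_mul, mul_div_mul_left _ _ hε.ne']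

theorem pointDistribution_real {ε : ℝ} (hε : 0 < ε) (μ : Measure ℝ) [IsFiniteMeasure μ]
    {A : Set ℝ} (hA : MeasurableSet A) :
    (pointDistribution ε μ).real A =
      (∫ t in A, pointRate ε (acDensity μ t)) / ∫ t, pointRate ε (acDensity μ t) := by
  have hnn : ∀ t, 0 ≤ pointRate ε (acDensity μ t) := fun t =>
    pointRate_nonneg hε (acDensity_nonneg μ t)
  have hnn' : ∀ t, 0 ≤ pointRate ε (acDensity μ t) / ∫ s, pointRate ε (acDensity μ s) :=
    fun t => div_nonneg (hnn t) (integral_nonneg hnn)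
  rw [pointDistribution_eq hε, measureReal_def, withDensity_apply _ hA,
    ← ofReal_integral_eq_lintegral_ofReal
      ((integrable_pointRate_acDensity μ hε).div_const _).integrableOn (ae_of_all _ hnn'),
    ENNReal.toReal_ofReal (integral_nonneg hnn'), integral_div]

theorem isProbabilityMeasure_pointDistribution {ε : ℝ} (hε : 0 < ε) {μ : Measure ℝ}
    [IsFiniteMeasure μ] (hμ : acPart μ ≠ 0) : IsProbabilityMeasure (pointDistribution ε μ) := by
  have h := pointDistribution_real hε μ MeasurableSet.univ
  rw [setIntegral_univ, div_self (integral_pointRate_pos hε hμ).ne', measureReal_def,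
    ENNReal.toReal_eq_one_iff] at h
  exact ⟨h⟩

theorem IsAsymptoticallyMinimal.eventually_bestErrorGiven_lt {ε : ℝ} (hε : 0 < ε)
    {μ : Measure ℝ} [IsProbabilityMeasure μ] {x : (n : ℕ) → Fin n → ℝ}
    (hx : IsAsymptoticallyMinimal ε μ x) {D : ℝ} (hD : ∫ t, pointRate ε (acDensity μ t) < D) :
    ∀ᶠ n : ℕ in atTop, bestErrorGiven ε μ (x n) < D / n := by
  have hC0 : 0 ≤ ∫ t, pointRate ε (acDensity μ t) :=
    integral_nonneg fun t => pointRate_nonneg hε (acDensity_nonneg μ t)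
  obtain ⟨D', hD', hDD'⟩ := exists_between hD
  have hD'0 : 0 < D' := hC0.trans_lt hD'
  filter_upwards [hx.2.eventually_lt_const ((one_lt_div hD'0).2 hDD'),
    hx.2.eventually_const_lt (show (0 : ℝ) < 1 by norm_num), eventually_bestError_le hε μ hD']
    with n h1 h0 h2
  -- A vanishing minimal error would make the quotient `0`.
  have h3 : 0 < bestError ε μ n := by
    refine (bestError_nonneg ε μ n).lt_of_ne' fun h => ?_
    simp [h] at h0
  rw [div_lt_iff₀ h3] at h1
  refine h1.trans_le ((mul_le_mul_of_nonneg_left h2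
    (div_pos (hD'0.trans hDD') hD'0).le).trans_eq ?_)
  field_simp

/-- The lower half of the convergence. Applied to an interval and to the two components of its
complement, it yields the upper half, because the proportions add up to `1`. -/
theorem IsAsymptoticallyMinimal.eventually_le_ncard_div {ε : ℝ} (hε : 0 < ε) {μ : Measure ℝ}
    [IsProbabilityMeasure μ] (hμ : acPart μ ≠ 0) {x : (n : ℕ) → Fin n → ℝ}
    (hx : IsAsymptoticallyMinimal ε μ x) {I : Set ℝ} (hI : I.OrdConnected) {δ : ℝ}
    (hδ : 0 < δ) :
    ∀ᶠ n : ℕ in atTop,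
      (pointDistribution ε μ).real I - δ ≤ (Set.ncard {j : Fin n | x n j ∈ I} : ℝ) / n := by
  have := isProbabilityMeasure_pointDistribution hε hμ
  have hC := integral_pointRate_pos hε hμ
  have hh := integrable_pointRate_acDensity μ hε
  have hnn : ∀ t, 0 ≤ pointRate ε (acDensity μ t) := fun t =>
    pointRate_nonneg hε (acDensity_nonneg μ t)
  set P := pointDistribution ε μ with hP
  set C := ∫ t, pointRate ε (acDensity μ t) with hCdef
  obtain ⟨K, hKI, hK, hlt⟩ := hI.measurableSet.exists_isCompact_lt_add (measure_ne_top P I)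
    (ENNReal.ofReal_pos.2 (half_pos hδ)).ne'
  have hPK : P.real I ≤ P.real K + δ / 2 := by
    have h1 := ENNReal.toReal_mono (by finiteness) hlt.le
    rwa [ENNReal.toReal_add (measure_ne_top P K) ENNReal.ofReal_ne_top,
      ENNReal.toReal_ofReal (half_pos hδ).le] at h1
  rcases K.eq_empty_or_nonempty with rfl | hKne
  · refine Eventually.of_forall fun n => ?_
    rw [measureReal_empty] at hPK
    have : (0 : ℝ) ≤ (Set.ncard {j : Fin n | x n j ∈ I} : ℝ) / n := by positivity
    linarith
  set a := sInf K with ha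
  set b := sSup K with hb
  have haK : a ∈ K := hK.sInf_mem hKne
  have hbK : b ∈ K := hK.sSup_mem hKne
  have hKab : K ⊆ Icc a b := fun t ht =>
    ⟨csInf_le hK.bddBelow ht, le_csSup hK.bddAbove ht⟩
  have hab : a ≤ b := (hKab haK).2
  have habI : Icc a b ⊆ I := hI.out (hKI haK) (hKI hbK)
  set J := ∫ t in Ioc a b, pointRate ε (acDensity μ t) with hJ
  have hJC : J ≤ C := setIntegral_le_integral hh (ae_of_all _ hnn)
  have hPJ : P.real I ≤ J / C + δ / 2 := by
    have h1 : P.real K ≤ P.real (Icc a b) := measureReal_mono hKab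
    rw [hP, pointDistribution_real hε μ measurableSet_Icc, integral_Icc_eq_integral_Ioc] at h1
    linarith
  -- With `D = C (1 + θ)` and `η = θ C` the quotient `(J - η) / D` is at least `J / C - 2 θ`.
  set θ := δ / 8 with hθ
  have hθ0 : 0 < θ := by positivity
  obtain ⟨M, hM⟩ := setIntegral_pointRate_le_countIoo hε μ hab (mul_pos hθ0 hC)
  have hD0 : 0 < C * (1 + θ) := by positivity
  have hMn : Tendsto (fun n : ℕ => M / (n : ℝ)) atTop (𝓝 0) :=
    tendsto_const_div_atTop_nhds_zero_nat M
  filter_upwards [hx.eventually_bestErrorGiven_lt hε (show C < C * (1 + θ) by nlinarith),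
    hMn.eventually_lt_const (show 0 < δ / 4 by positivity), eventually_gt_atTop 0]
    with n h1 h2 hn
  obtain ⟨p, hp, hlt⟩ := exists_levyDist_lt_of_bestErrorGiven_lt hn h1
  have hn' : (0 : ℝ) < n := by exact_mod_cast hn
  have hy0 : 0 < C * (1 + θ) / n := by positivity
  have h3 := hM n (x n) _ hy0 fun a b hab hno => by
    rcases hab.eq_or_lt with rfl | hab
    · exact gapBound_self hε μ hy0.le a
    · exact gapBound_of_levyDist_lt hε hp hlt hab hno
  have h4 : (countIoo (x n) a b : ℝ) / n ≤ (Set.ncard {j : Fin n | x n j ∈ I} : ℝ) / n := by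
    gcongr
    exact ncard_le_ncard (fun j hj => habI (Ioo_subset_Icc_self hj)) (toFinite _)
  have h5 : (J - θ * C) / (C * (1 + θ)) ≤ (countIoo (x n) a b : ℝ) / n + M / n := by
    rw [div_le_iff₀ hD0]
    exact h3.trans_eq (by ring)
  have h6 : J / C - 2 * θ ≤ (J - θ * C) / (C * (1 + θ)) := by
    have h7 : J / C ≤ 1 := (div_le_one hC).2 hJC
    have h8 : J / C * C = J := div_mul_cancel₀ _ hC.ne'
    rw [le_div_iff₀ hD0]
    nlinarith [mul_pos hC hθ0, mul_pos (mul_pos hC hθ0) hθ0,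
      mul_le_mul_of_nonneg_left h7 (mul_pos hC hθ0).le]
  linarith

theorem mainTheorem4 (μ : Measure ℝ) [IsProbabilityMeasure μ] (ε : ℝ) (hε : 0 < ε)
    (hμ : acPart μ ≠ 0) (x : (n : ℕ) → Fin n → ℝ) (hx : IsAsymptoticallyMinimal ε μ x)
    (I : Set ℝ) (hI : I.OrdConnected) :
    Tendsto (fun n : ℕ => (Set.ncard {j : Fin n | x n j ∈ I} : ℝ) / (n : ℝ)) atTop
      (𝓝 ((pointDistribution ε μ).real I)) := by
  have := isProbabilityMeasure_pointDistribution hε hμ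
  rcases I.eq_empty_or_nonempty with rfl | hne
  · simp
  -- The complement of `I` consists of two intervals, to which the lower bound applies as well.
  set L : Set ℝ := {t | ∀ s ∈ I, t < s} with hL
  set R : Set ℝ := {t | ∀ s ∈ I, s < t} with hR
  have hLo : L.OrdConnected := ⟨fun a _ b hb t ht s hs => ht.2.trans_lt (hb s hs)⟩
  have hRo : R.OrdConnected := ⟨fun a ha b _ t ht s hs => (ha s hs).trans_le ht.1⟩
  have hLI : Disjoint L I := Set.disjoint_left.2 fun t h h' => lt_irrefl _ (h t h')
  have hRI : Disjoint (L ∪ I) R := by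
    obtain ⟨s, hs⟩ := hne
    refine Set.disjoint_left.2 ?_
    rintro t (h | h) h'
    · exact lt_asymm (h s hs) (h' s hs)
    · exact lt_irrefl _ (h' t h)
  have huniv : L ∪ I ∪ R = univ := by
    refine eq_univ_of_forall fun t => ?_
    by_contra hcon
    simp only [mem_union, not_or, hL, hR, mem_ofPred_eq, not_forall, not_lt] at hcon
    obtain ⟨⟨⟨s, hs, hst⟩, htI⟩, s', hs', hts'⟩ := hcon
    exact htI (hI.out hs hs' ⟨hst, hts'⟩)
  have hsum : (pointDistribution ε μ).real L + (pointDistribution ε μ).real I +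
      (pointDistribution ε μ).real R = 1 := by
    rw [← measureReal_union hLI hI.measurableSet, ← measureReal_union hRI hRo.measurableSet,
      huniv, probReal_univ]
  have hcount : ∀ n : ℕ, 0 < n → (Set.ncard {j : Fin n | x n j ∈ L} : ℝ) / n +
      (Set.ncard {j : Fin n | x n j ∈ I} : ℝ) / n +
      (Set.ncard {j : Fin n | x n j ∈ R} : ℝ) / n = 1 := by
    intro n hn
    have h1 : {j : Fin n | x n j ∈ L}.ncard + {j : Fin n | x n j ∈ I}.ncard +
        {j : Fin n | x n j ∈ R}.ncard = n := by
      change (x n ⁻¹' L).ncard + (x n ⁻¹' I).ncard + (x n ⁻¹' R).ncard = n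
      rw [← ncard_union_eq (hLI.preimage (x n)), ← preimage_union,
        ← ncard_union_eq (hRI.preimage (x n)), ← preimage_union, huniv, preimage_univ, ncard_univ,
        Nat.card_fin]
    have h2 : (n : ℝ) ≠ 0 := by positivity
    rw [← add_div, ← add_div, div_eq_one_iff_eq h2]
    exact_mod_cast h1
  rw [Metric.tendsto_nhds]
  intro δ hδ
  have hδ3 : 0 < δ / 3 := by positivity
  filter_upwards [hx.eventually_le_ncard_div hε hμ hI hδ3, hx.eventually_le_ncard_div hε hμ hLo hδ3,
    hx.eventually_le_ncard_div hε hμ hRo hδ3, eventually_gt_atTop 0] with n h1 h2 h3 hn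
  have h4 := hcount n hn
  rw [Real.dist_eq, abs_lt]
  constructor <;> linarith
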